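/- Let $K$ be a connected compact Lie group with center $Z(K)$ and Lie algebra $\mathfrak k$. Let $L=K/Z(K)$ with its quotient Lie group structure (the one for which the projection $\pi:K\to L$ is a smooth submersion), let $\mathfrak l$ be the Lie algebra of $L$, and let $\mathfrak z\subset\mathfrak k$ be the Lie algebra of $Z(K)$. For $\mathfrak g=\mathfrak k$ or $\mathfrak l$ write $$(\mathfrak g^*\oplus\mathfrak g)^c=\{(\mu,\xi)\in\mathfrak g^*\oplus\mathfrak g:\ \mathrm{coad}_\xi\mu=0\},\qquad (\mathrm{coad}_\xi\mu)(\eta)=-\mu([\xi,\eta]).$$ Let $K$ act on $\mathfrak k^*\oplus\mathfrak k$ by the product of the coadjoint and adjoint actions, on $\mathfrak l^*\oplus\mathfrak l$ through $\pi$ and the product of the coadjoint and adjoint actions of $L$, and trivially on $\mathfrak z^*\oplus\mathfrak z$. Then every $K$-invariant inner product on $\mathfrak k$ determines a $K$-equivariant linear isomorphism $$\sigma:\mathfrak k^*\oplus\mathfrak k\to(\mathfrak l^*\oplus\mathfrak l)\oplus(\mathfrak z^*\oplus\mathfrak z).$$ Explicitly, $\sigma(\mu,\xi)=\bigl((\lambda,d\pi_1(\xi)),(\mu|_{\mathfrak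 z},P\xi)\bigr)$, where $P:\mathfrak k\to\mathfrak z$ is the orthogonal projection and $\lambda\in\mathfrak l^*$ is the functional with $\lambda(d\pi_1(\eta))=\mu(\eta)$ for all $\eta\in\mathfrak z^\perp$; there is exactly one linear isomorphism of this form. Moreover $$\sigma\bigl(\mathrm{fix}(K;\mathfrak k^*\oplus\mathfrak k)\bigr)=\{0\}\oplus(\mathfrak z^*\oplus\mathfrak z),\qquad \sigma\bigl((\mathfrak k^*\oplus\mathfrak k)^c\bigr)=(\mathfrak l^*\oplus\mathfrak l)^c\oplus(\mathfrak z^*\oplus\mathfrak z).$$ -/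

import Mathlib

open scoped Manifold ContDiff

noncomputable section

namespace CompactLie

instance instLEInftyMinSmoothness : ENat.LEInfty (minSmoothness ℝ 3) :=
  ⟨by rw [minSmoothness_of_isRCLikeNormedField]; exact ENat.LEInfty.out⟩

section

variable {E : Type*} [NormedAddCommGroup E] [NormedSpace ℝ E]
  {H : Type*} [TopologicalSpace H] (I : ModelWithCorners ℝ E H)
  {G : Type*} [TopologicalSpace G] [ChartedSpace H G] [Group G]

/-- The adjoint action `Ad_g`: the derivative at `1` of the conjugation `x ↦ g x g⁻¹`. -/
def Ad (g : G) : GroupLieAlgebra I G →ₗ[ℝ] GroupLieAlgebra I G :=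
  (mfderiv I I (fun x : G => g * x * g⁻¹) 1 : E →L[ℝ] E).toLinearMap

/-- The coadjoint action of `g`: the functional `μ` is sent to `μ ∘ Ad_{g⁻¹}`. -/
def coAd (g : G) :
    Module.Dual ℝ (GroupLieAlgebra I G) →ₗ[ℝ] Module.Dual ℝ (GroupLieAlgebra I G) :=
  Module.Dual.transpose (R := ℝ) (Ad I g⁻¹)

/-- The product of the coadjoint and the adjoint action, on `𝔤* ⊕ 𝔤`. -/
def coAdAd (g : G) :
    (Module.Dual ℝ (GroupLieAlgebra I G) × GroupLieAlgebra I G) →ₗ[ℝ]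
      (Module.Dual ℝ (GroupLieAlgebra I G) × GroupLieAlgebra I G) :=
  (coAd I g).prodMap (Ad I g)

variable (G) in
/-- The points of `𝔤* ⊕ 𝔤` that are fixed by all of `G`. -/
def fixedPairs : Set (Module.Dual ℝ (GroupLieAlgebra I G) × GroupLieAlgebra I G) :=
  {p | ∀ g : G, coAdAd I g p = p}

variable (G) in
/-- The set `(𝔤* ⊕ 𝔤)ᶜ` of pairs `(μ, ξ)` with `coad_ξ μ = 0`. The bracket of `ξ` and `μ` is the
coadjoint action of the Lie algebra on its dual, `⁅ξ, μ⁆ η = - μ ⁅ξ, η⁆`. -/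
def commutingPairs [CompleteSpace E] [LieGroup I ∞ G] :
    Set (Module.Dual ℝ (GroupLieAlgebra I G) × GroupLieAlgebra I G) :=
  {p | ⁅p.2, p.1⁆ = 0}

/-- An inner product on the Lie algebra of `G` that is invariant under the adjoint action. -/
structure IsInvariantInnerProduct
    (B : GroupLieAlgebra I G →ₗ[ℝ] GroupLieAlgebra I G →ₗ[ℝ] ℝ) : Prop where
  symm : ∀ x y, B x y = B y x
  pos : ∀ x, x ≠ 0 → 0 < B x x
  inv : ∀ (g : G) (x y), B (Ad I g x) (Ad I g y) = B x y

/-- The product of two curves through `1` has the sum of their velocities as its velocity. -/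
theorem hasMFDerivAt_curve_mul [LieGroup I ∞ G] {γ δ : ℝ → G} {v w : E}
    (hγ : γ 0 = 1) (hδ : δ 0 = 1)
    (h : HasMFDerivAt 𝓘(ℝ, ℝ) I γ 0 (ContinuousLinearMap.toSpanSingleton ℝ v))
    (h' : HasMFDerivAt 𝓘(ℝ, ℝ) I δ 0 (ContinuousLinearMap.toSpanSingleton ℝ w)) :
    HasMFDerivAt 𝓘(ℝ, ℝ) I (fun t => γ t * δ t) 0
      (ContinuousLinearMap.toSpanSingleton ℝ (v + w)) := by
  have hm : MDifferentiableAt (I.prod I) I (fun p : G × G => p.1 * p.2) (γ 0, δ 0) :=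
    (contMDiff_mul I ∞).mdifferentiableAt (by simp)
  have hc := HasMFDerivAt.comp (I' := I.prod I) (0 : ℝ) hm.hasMFDerivAt (h.prodMk h')
  have e : (mfderiv (I.prod I) I (fun p : G × G => p.1 * p.2) (γ 0, δ 0) :
      E × E →L[ℝ] E) = ContinuousLinearMap.coprod (.id ℝ E) (.id ℝ E) := by
    have hid : ∀ (f : G → G) (x : G), f = id →
        (mfderiv I I f x : E →L[ℝ] E) = ContinuousLinearMap.id ℝ E := by
      rintro f x rfl
      exact mfderiv_id
    refine ContinuousLinearMap.ext fun x => ?_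
    refine (mfderiv_prod_eq_add_apply (v := x) hm).trans ?_
    exact congrArg₂ (fun f g : E →L[ℝ] E => f x.1 + g x.2)
      (hid (fun z => z * δ 0) (γ 0) (by ext; simp [hδ]))
      (hid (fun z => γ 0 * z) (δ 0) (by ext; simp [hγ]))
  refine hc.congr_mfderiv (ContinuousLinearMap.ext fun (t : ℝ) => ?_)
  refine (congrArg (fun f : E × E →L[ℝ] E => f (t • v, t • w)) e).trans ?_
  exact (smul_add t v w).symm

variable (G) in
/-- The Lie algebra of the center of `G`, as a subspace of the Lie algebra of `G`: the velocities
at `0` of the one-parameter subgroups of `G` that lie in the center. (A homomorphism `γ : ℝ → G`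
with a derivative at `0` is automatically smooth.) -/
def centerLie [LieGroup I ∞ G] : Submodule ℝ (GroupLieAlgebra I G) where
  carrier := {v | ∃ γ : ℝ → G, (∀ s t, γ (s + t) = γ s * γ t) ∧
    (∀ t, γ t ∈ Subgroup.center G) ∧
    HasMFDerivAt 𝓘(ℝ, ℝ) I γ 0 (ContinuousLinearMap.toSpanSingleton ℝ (v : E))}
  zero_mem' := by
    refine ⟨fun _ => 1, by simp, fun _ => one_mem _, ?_⟩
    have h : ContinuousLinearMap.toSpanSingleton ℝ (0 : E) = 0 := by ext; simp
    exact h ▸ hasMFDerivAt_const (I := 𝓘(ℝ, ℝ)) (I' := I) (1 : G) (0 : ℝ)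
  add_mem' := by
    rintro v w ⟨γ, h1, h2, h3⟩ ⟨δ, k1, k2, k3⟩
    have e1 : γ 0 = 1 := by simpa using h1 0 0
    have e2 : δ 0 = 1 := by simpa using k1 0 0
    refine ⟨fun t => γ t * δ t, fun s t => ?_, fun t => mul_mem (h2 t) (k2 t),
      hasMFDerivAt_curve_mul I e1 e2 h3 k3⟩
    change γ (s + t) * δ (s + t) = (γ s * δ s) * (γ t * δ t)
    rw [h1, k1, mul_assoc, mul_assoc, ← mul_assoc (γ t),
      (Subgroup.mem_center_iff.1 (h2 t) (δ s)).symm, mul_assoc]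
  smul_mem' := by
    rintro c v ⟨γ, h1, h2, h3⟩
    refine ⟨fun t => γ (c * t), fun s t => (congrArg γ (mul_add c s t)).trans (h1 _ _), fun t => h2 _, ?_⟩
    have hl : HasMFDerivAt 𝓘(ℝ, ℝ) 𝓘(ℝ, ℝ) (fun t : ℝ => c * t) 0
        (ContinuousLinearMap.toSpanSingleton ℝ c) :=
      (((hasDerivAt_id (0 : ℝ)).const_mul c).congr_deriv (mul_one c)).hasFDerivAt.hasMFDerivAt
    have h3' : HasMFDerivAt 𝓘(ℝ, ℝ) I γ (c * 0)
        (ContinuousLinearMap.toSpanSingleton ℝ (v : E)) := by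
      rw [mul_zero]; exact h3
    refine (HasMFDerivAt.comp (I' := 𝓘(ℝ, ℝ)) (0 : ℝ) h3' hl).congr_mfderiv
      (ContinuousLinearMap.ext fun (t : ℝ) => ?_)
    exact (smul_smul t c (v : E)).symm

end

section

variable {E : Type*} [NormedAddCommGroup E] [NormedSpace ℝ E]
  {H : Type*} [TopologicalSpace H] (I : ModelWithCorners ℝ E H)
  {K : Type*} [TopologicalSpace K] [ChartedSpace H K] [Group K]
  {E' : Type*} [NormedAddCommGroup E'] [NormedSpace ℝ E']
  {H' : Type*} [TopologicalSpace H'] (I' : ModelWithCorners ℝ E' H')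
  [ChartedSpace H' (K ⧸ Subgroup.center K)]

variable (K) in
/-- The smooth structure of `K ⧸ Z(K)` is the quotient one: the projection is a smooth
submersion. -/
structure IsQuotientStructure : Prop where
  contMDiff : ContMDiff I I' ∞ (QuotientGroup.mk : K → K ⧸ Subgroup.center K)
  surjective_mfderiv : ∀ x : K,
    Function.Surjective (mfderiv I I' (QuotientGroup.mk : K → K ⧸ Subgroup.center K) x)

variable (K) in
/-- The map of Lie algebras `𝔨 → 𝔩` induced by the projection `K → K ⧸ Z(K)`. -/
def projLie : GroupLieAlgebra I K →ₗ[ℝ] GroupLieAlgebra I' (K ⧸ Subgroup.center K) :=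
  (mfderiv I I' (QuotientGroup.mk : K → K ⧸ Subgroup.center K) 1 : E →L[ℝ] E').toLinearMap

/-- The map `σ : 𝔨* ⊕ 𝔨 → (𝔩* ⊕ 𝔩) ⊕ (𝔷* ⊕ 𝔷)` is the one that the inner product `B` determines:
`𝔨 = 𝔷ᗮ ⊕ 𝔷`, with `𝔷ᗮ` carried to `𝔩` by the projection, and dually `𝔨* = 𝔩* ⊕ 𝔷*`. That is, the
components of `σ (μ, ξ)` are the image of `ξ` in `𝔩`, the `B`-orthogonal projection of `ξ` to `𝔷`,
the functional on `𝔩` whose pullback agrees with `μ` on `𝔷ᗮ`, and the restriction of `μ`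
to `𝔷`. -/
structure IsInducedSplitting [LieGroup I ∞ K]
    (B : GroupLieAlgebra I K →ₗ[ℝ] GroupLieAlgebra I K →ₗ[ℝ] ℝ)
    (σ : (Module.Dual ℝ (GroupLieAlgebra I K) × GroupLieAlgebra I K) ≃ₗ[ℝ]
      (Module.Dual ℝ (GroupLieAlgebra I' (K ⧸ Subgroup.center K)) ×
          GroupLieAlgebra I' (K ⧸ Subgroup.center K)) ×
        (Module.Dual ℝ (centerLie I K) × centerLie I K)) : Prop where
  snd_l : ∀ μ ξ, (σ (μ, ξ)).1.2 = projLie I K I' ξ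
  snd_z : ∀ μ ξ, ∀ ζ : centerLie I K, B (σ (μ, ξ)).2.2 ζ = B ξ ζ
  fst_l : ∀ μ ξ η, (∀ ζ : centerLie I K, B η ζ = 0) →
    (σ (μ, ξ)).1.1 (projLie I K I' η) = μ η
  fst_z : ∀ μ ξ, ∀ ζ : centerLie I K, (σ (μ, ξ)).2.1 ζ = μ ζ

end

end CompactLie

end

/-! Write 𝔷 for the Lie algebra of the center and π for the projection 𝔨 → 𝔩. The theorem is linear
algebra once four facts are known: ker π = 𝔷; 𝔷 is exactly the set of vectors fixed by Ad; π
intertwines both the adjoint actions and the brackets; and all brackets are B-orthogonal to 𝔷.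

Given these, 𝔨 = 𝔷ᗮ ⊕ 𝔷, π maps 𝔷ᗮ isomorphically to 𝔩, and dualizing gives σ. It is equivariant
because Ad preserves B and fixes 𝔷 pointwise, hence preserves 𝔷ᗮ. If (μ, ξ) is fixed, then ξ ∈ 𝔷,
and the vector m with μ = B(m, ·) is fixed too, so m ∈ 𝔷 and μ vanishes on 𝔷ᗮ. Finally [ξ, η] ∈ 𝔷ᗮ
gives μ[ξ, η] = λ(π[ξ, η]) = λ[πξ, πη], which matches the commuting pairs.

The first two facts come from one-parameter subgroups: each velocity has exactly one
(`exists_hom_hasMFDerivAt`, `hom_ext_of_hasMFDerivAt`), so an Ad-fixed velocity generates a central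
subgroup, and a velocity killed by π generates one with trivial image in K/Z(K). The facts about
brackets are computed in the chart at 1, where the bracket is the antisymmetrized mixed second
derivative of the multiplication. Orthogonality holds because B(ζ, ·), for ζ ∈ 𝔷, is an Ad-invariant
functional, and such functionals kill brackets (`apply_lie_eq_zero_of_forall_Ad`). -/

noncomputable section

namespace CompactLie

/-! ### Linear algebra: the splitting attached to a positive definite form -/

section Splitting

variable {V L : Type*} [AddCommGroup V] [Module ℝ V] [FiniteDimensional ℝ V]
  [AddCommGroup L] [Module ℝ L]
  {B : V →ₗ[ℝ] V →ₗ[ℝ] ℝ} {Z : Submodule ℝ V} {π : V →ₗ[ℝ] L}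

/-- A positive definite form on a finite-dimensional space represents every functional. -/
theorem exists_eq_of_posDef (hpos : ∀ x, x ≠ 0 → 0 < B x x) (f : Module.Dual ℝ V) :
    ∃ m, B m = f := by
  have hinj : Function.Injective B := by
    refine (injective_iff_map_eq_zero B).2 fun x hx => ?_
    by_contra h
    exact (hpos x h).ne' (by rw [hx]; rfl)
  exact (LinearMap.injective_iff_surjective_of_finrank_eq_finrank
    (Subspace.dual_finrank_eq (K := ℝ) (V := V)).symm).1 hinj f

/-- The orthogonal projection onto a subspace, for a positive definite form. -/
theorem exists_orthogonal_projection (hpos : ∀ x, x ≠ 0 → 0 < B x x) (Z : Submodule ℝ V) :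
    ∃ P : V →ₗ[ℝ] Z, ∀ ξ, ∀ ζ : Z, B (P ξ) ζ = B ξ ζ := by
  let BZ : Z →ₗ[ℝ] Module.Dual ℝ Z := (B.domRestrict₁₂ Z Z)
  have hZ : ∀ x : Z, x ≠ 0 → 0 < BZ x x := fun x hx => hpos x (by simpa using hx)
  have hinj : Function.Injective BZ := by
    refine (injective_iff_map_eq_zero BZ).2 fun x hx => ?_
    by_contra h
    exact (hZ x h).ne' (by rw [hx]; rfl)
  let e := LinearEquiv.ofBijective BZ ⟨hinj, exists_eq_of_posDef hZ⟩
  -- The projection of ξ is the vector of Z that represents the restriction of B(ξ, ·) to Z.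
  refine ⟨e.symm.toLinearMap ∘ₗ (Z.subtype.dualMap ∘ₗ B), fun ξ ζ => ?_⟩
  exact LinearMap.congr_fun (e.apply_symm_apply (Z.subtype.dualMap (B ξ))) ζ

omit [FiniteDimensional ℝ V] in
theorem eq_zero_of_form_self_eq_zero (hpos : ∀ x, x ≠ 0 → 0 < B x x) {x : V} (hx : B x x = 0) :
    x = 0 := by
  by_contra h
  exact (hpos x h).ne' hx

variable (B π) in
/-- The formulas for the components of `σ`. -/
def IsSplitting (σ : (Module.Dual ℝ V × V) ≃ₗ[ℝ] (Module.Dual ℝ L × L) × (Module.Dual ℝ Z × Z)) :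
    Prop :=
  ∀ μ ξ, (σ (μ, ξ)).1.2 = π ξ ∧ (∀ ζ : Z, B (σ (μ, ξ)).2.2 ζ = B ξ ζ) ∧
    (∀ η, (∀ ζ : Z, B η ζ = 0) → (σ (μ, ξ)).1.1 (π η) = μ η) ∧
    ∀ ζ : Z, (σ (μ, ξ)).2.1 ζ = μ ζ

/-- The splitting `V* ⊕ V ≃ (L* ⊕ L) ⊕ (Z* ⊕ Z)` that a positive definite form on `V` determines
for a surjection `V → L` with kernel `Z`. -/
theorem exists_splitting (hpos : ∀ x, x ≠ 0 → 0 < B x x)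
    (hsurj : Function.Surjective π) (hker : LinearMap.ker π = Z) :
    ∃ σ : (Module.Dual ℝ V × V) ≃ₗ[ℝ]
        (Module.Dual ℝ L × L) × (Module.Dual ℝ Z × Z),
      IsSplitting B π σ := by
  obtain ⟨P, hP⟩ := exists_orthogonal_projection hpos Z
  have hπZ : ∀ z : Z, π z = 0 := fun z => LinearMap.mem_ker.1 (hker ▸ z.2)
  have hPz : ∀ z : Z, P z = z := fun z => by
    have h : B ((P z : V) - z) ((P z - z : Z) : V) = 0 := by
      rw [map_sub, LinearMap.sub_apply, hP, sub_self]
    exact Subtype.ext (sub_eq_zero.1 (eq_zero_of_form_self_eq_zero hpos (by simpa using h)))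
  have hPorth : ∀ η, (∀ ζ : Z, B η ζ = 0) → P η = 0 := fun η hη => by
    refine Subtype.ext (eq_zero_of_form_self_eq_zero hpos ?_)
    rw [hP, hη]
  let e : V ≃ₗ[ℝ] L × Z := LinearEquiv.ofBijective (π.prod P) (by
    constructor
    · refine (injective_iff_map_eq_zero _).2 fun x hx => ?_
      have h1 : π x = 0 := congrArg Prod.fst hx
      have h2 : P x = 0 := congrArg Prod.snd hx
      have hx : x ∈ Z := hker ▸ LinearMap.mem_ker.2 h1
      rw [hPz ⟨x, hx⟩] at h2
      exact congrArg Subtype.val h2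
    · rintro ⟨l, z⟩
      obtain ⟨ξ, rfl⟩ := hsurj l
      refine ⟨ξ - P ξ + z, Prod.ext ?_ ?_⟩
      · simp [hπZ]
      · simp [hPz])
  have he : ∀ ξ, e ξ = (π ξ, P ξ) := fun _ => rfl
  -- Dualizing V ≃ L × Z: the L-component of μ evaluates μ on the lift of a vector of L that is
  -- orthogonal to Z.
  let d : Module.Dual ℝ V ≃ₗ[ℝ] Module.Dual ℝ L × Module.Dual ℝ Z :=
    e.symm.dualMap.trans (Module.dualProdDualEquivDual ℝ L Z).symm
  have hd : ∀ μ, d μ = (μ ∘ₗ e.symm.toLinearMap ∘ₗ LinearMap.inl ℝ L Z,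
      μ ∘ₗ e.symm.toLinearMap ∘ₗ LinearMap.inr ℝ L Z) := fun _ => rfl
  refine ⟨(d.prodCongr e).trans (LinearEquiv.prodProdProdComm ℝ _ _ _ _), fun μ ξ => ?_⟩
  have hσ : ((d.prodCongr e).trans (LinearEquiv.prodProdProdComm ℝ _ _ _ _)) (μ, ξ) =
      (((d μ).1, π ξ), ((d μ).2, P ξ)) := rfl
  rw [hσ]
  refine ⟨rfl, hP ξ, fun η hη => ?_, fun ζ => ?_⟩
  · have h : e.symm (π η, 0) = η := by rw [e.symm_apply_eq, he, hPorth η hη]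
    simp only [hd]
    exact congrArg μ h
  · have h : e.symm (0, ζ) = ζ := by rw [e.symm_apply_eq, he, hPz ζ, hπZ]
    simp only [hd]
    exact congrArg μ h

end Splitting

/-! ### One-parameter subgroups as integral curves of left invariant fields -/

section OneParameter

open Set Filter Topology

variable {E : Type*} [NormedAddCommGroup E] [NormedSpace ℝ E]
  {H : Type*} [TopologicalSpace H] {I : ModelWithCorners ℝ E H}
  {G : Type*} [TopologicalSpace G] [ChartedSpace H G] [Group G] [LieGroup I ∞ G]

theorem mdifferentiableAt_mul_left (g x : G) : MDifferentiableAt I I (g * ·) x :=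
  (contMDiff_mul_left (I := I) (n := ∞)).mdifferentiableAt (by simp)

theorem mulInvariantVectorField_mul (v : GroupLieAlgebra I G) (g h : G) :
    (mulInvariantVectorField v (g * h) : E) =
      (mfderiv I I (g * ·) h : E →L[ℝ] E) (mulInvariantVectorField v h : E) := by
  have e : (fun x : G => g * h * x) = (g * ·) ∘ (h * ·) := by ext x; simp [mul_assoc]
  have hc := HasMFDerivAt.comp (I' := I) (1 : G)
    (mdifferentiableAt_mul_left (I := I) g (h * 1)).hasMFDerivAt
    (mdifferentiableAt_mul_left (I := I) h 1).hasMFDerivAt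
  rw [← e] at hc
  have hh : h * 1 = h := mul_one h
  have := congrArg (fun f : E →L[ℝ] E => f v) hc.mfderiv
  refine this.trans ?_
  change (mfderiv I I (g * ·) (h * 1) : E →L[ℝ] E) _ = _
  rw [hh]
  rfl

omit [LieGroup I ∞ G] in
theorem mulInvariantVectorField_one (v : GroupLieAlgebra I G) :
    (mulInvariantVectorField v (1 : G) : E) = v := by
  have e : (fun x : G => 1 * x) = id := by ext x; simp
  have : (mfderiv I I (fun x : G => 1 * x) 1 : E →L[ℝ] E) = ContinuousLinearMap.id ℝ E := by
    rw [e]; exact mfderiv_id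
  exact congrArg (fun f : E →L[ℝ] E => f v) this

theorem contMDiff_one_mulInvariantVectorField (v : GroupLieAlgebra I G) :
    ContMDiff I I.tangent 1 (fun g : G => (⟨g, mulInvariantVectorField v g⟩ : TangentBundle I G)) :=
  (contMDiff_mulInvariantVectorField v).of_le
    ((by norm_num : (1 : ℕ∞ω) ≤ 2).trans le_minSmoothness)

/-- A left translate of an integral curve of a left invariant vector field is one as well. -/
theorem isMIntegralCurveOn_mul_left {v : GroupLieAlgebra I G} {γ : ℝ → G} {s : Set ℝ}
    (hγ : IsMIntegralCurveOn γ (mulInvariantVectorField (I := I) v) s) (g : G) :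
    IsMIntegralCurveOn (fun t => g * γ t) (mulInvariantVectorField (I := I) v) s := by
  intro t ht
  refine (HasMFDerivAt.comp_hasMFDerivWithinAt (I' := I) t
    (mdifferentiableAt_mul_left (I := I) g (γ t)).hasMFDerivAt (hγ t ht)).congr_mfderiv ?_
  refine ContinuousLinearMap.ext fun (r : ℝ) => ?_
  refine (map_smul (mfderiv I I (g * ·) (γ t) : E →L[ℝ] E) r _).trans ?_
  exact congrArg (r • ·) (mulInvariantVectorField_mul v g (γ t)).symm

/-- A one-parameter subgroup is an integral curve of the left invariant vector field that its
velocity at `0` generates. -/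
theorem isMIntegralCurve_of_hom {v : GroupLieAlgebra I G} {γ : ℝ → G}
    (hγ : ∀ s t, γ (s + t) = γ s * γ t)
    (h : HasMFDerivAt 𝓘(ℝ, ℝ) I γ 0 (ContinuousLinearMap.toSpanSingleton ℝ (v : E))) :
    IsMIntegralCurve γ (mulInvariantVectorField (I := I) v) := by
  intro t
  have h0 : γ 0 = 1 := by simpa using hγ 0 0
  -- γ(s) = γ(t) γ(s - t) moves the derivative at t to the derivative at 0.
  have e : γ = (γ t * ·) ∘ γ ∘ (fun s => s - t) := by
    ext s; simp [← hγ]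
  have hs : HasMFDerivAt 𝓘(ℝ, ℝ) 𝓘(ℝ, ℝ) (fun s : ℝ => s - t) t
      (ContinuousLinearMap.id ℝ ℝ) :=
    ((hasFDerivAt_id t).sub_const t).hasMFDerivAt
  have h' : HasMFDerivAt 𝓘(ℝ, ℝ) I γ (t - t) (ContinuousLinearMap.toSpanSingleton ℝ (v : E)) := by
    rw [sub_self]; exact h
  have hc := HasMFDerivAt.comp (I' := I) t
    (mdifferentiableAt_mul_left (I := I) (γ t) (γ (t - t))).hasMFDerivAt
    (HasMFDerivAt.comp (I' := 𝓘(ℝ, ℝ)) (f := fun s : ℝ => s - t) t h' hs)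
  have hone : γ (t - t) = 1 := by rw [sub_self, h0]
  refine (hc.congr_of_eventuallyEq (Eventually.of_forall fun s => congrFun e s)).congr_mfderiv
    (ContinuousLinearMap.ext fun (r : ℝ) => ?_)
  change (mfderiv I I (γ t * ·) (γ (t - t)) : E →L[ℝ] E) (r • (v : E)) = _
  rw [hone]
  exact map_smul (mfderiv I I (γ t * ·) (1 : G) : E →L[ℝ] E) r (v : E)

variable [T2Space G] [BoundarylessManifold I G]

/-- A one-parameter subgroup is determined by its velocity at `0`. -/
theorem hom_ext_of_hasMFDerivAt {v : E} {γ δ : ℝ → G}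
    (hγ : ∀ s t, γ (s + t) = γ s * γ t) (hδ : ∀ s t, δ (s + t) = δ s * δ t)
    (h : HasMFDerivAt 𝓘(ℝ, ℝ) I γ 0 (ContinuousLinearMap.toSpanSingleton ℝ v))
    (h' : HasMFDerivAt 𝓘(ℝ, ℝ) I δ 0 (ContinuousLinearMap.toSpanSingleton ℝ v)) : γ = δ := by
  have e1 : γ 0 = 1 := by simpa using hγ 0 0
  have e2 : δ 0 = 1 := by simpa using hδ 0 0
  have : IsManifold I 1 G := IsManifold.of_le (n := ∞) (by norm_num)
  exact isMIntegralCurve_Ioo_eq_of_contMDiff_boundaryless (t₀ := 0)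
    (contMDiff_one_mulInvariantVectorField (I := I) (G := G) v)
    (isMIntegralCurve_of_hom hγ h) (isMIntegralCurve_of_hom hδ h') (e1.trans e2.symm)

/-- Every vector of the Lie algebra is the velocity of a one-parameter subgroup. -/
theorem exists_hom_hasMFDerivAt [CompleteSpace E] (v : GroupLieAlgebra I G) :
    ∃ γ : ℝ → G, (∀ s t, γ (s + t) = γ s * γ t) ∧
      HasMFDerivAt 𝓘(ℝ, ℝ) I γ 0 (ContinuousLinearMap.toSpanSingleton ℝ (v : E)) := by
  have : IsManifold I 1 G := IsManifold.of_le (n := ∞) (by norm_num)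
  have hv := contMDiff_one_mulInvariantVectorField v
  obtain ⟨γ₀, h0, hγ₀⟩ := exists_isMIntegralCurveAt_of_contMDiffAt_boundaryless 0
    (hv.contMDiffAt (x := 1))
  obtain ⟨ε, hε, hγ₀⟩ := isMIntegralCurveAt_iff'.1 hγ₀
  rw [Real.ball_eq_Ioo, zero_sub, zero_add] at hγ₀
  -- Left translates of the local solution through 1 solve on the same interval (-ε, ε) through
  -- every point; this uniform existence time makes the field complete.
  obtain ⟨γ, h1, hγ⟩ := exists_isMIntegralCurve_of_isMIntegralCurveOn hv hε
    (fun x => ⟨fun t => x * γ₀ t, by simp [h0], isMIntegralCurveOn_mul_left hγ₀ x⟩) 1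
  refine ⟨γ, fun s t => ?_, ?_⟩
  · have hs := isMIntegralCurve_iff_isMIntegralCurveOn.2
      (isMIntegralCurveOn_mul_left (isMIntegralCurve_iff_isMIntegralCurveOn.1 hγ) (γ s))
    have h := isMIntegralCurve_Ioo_eq_of_contMDiff_boundaryless (t₀ := 0) hv
      (hγ.comp_add s) hs (by simp [h1])
    have := congrFun h t
    simpa [add_comm] using this
  · refine (hγ 0).congr_mfderiv (ContinuousLinearMap.ext fun (r : ℝ) => ?_)
    change r • (mulInvariantVectorField v (γ 0) : E) = r • (v : E)
    rw [h1, mulInvariantVectorField_one]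

end OneParameter

/-! ### The Lie algebra of the center: Ad-fixed vectors and the kernel of the projection -/

section Center

open Set Filter Topology

/-- The center is closed, as an intersection of equalizers. Separation of the quotient is what makes
integral curves there unique. -/
theorem t2Space_quotient_center {K : Type*} [TopologicalSpace K] [Group K] [IsTopologicalGroup K]
    [T2Space K] : T2Space (K ⧸ Subgroup.center K) := by
  have : IsClosed (Subgroup.center K : Set K) := by
    have e : (Subgroup.center K : Set K) = ⋂ g : K, {x | g * x = x * g} := by
      ext x; simp [Subgroup.mem_center_iff]
    rw [e]
    exact isClosed_iInter fun g => isClosed_eq (by fun_prop) (by fun_prop)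
  infer_instance

variable {E : Type*} [NormedAddCommGroup E] [NormedSpace ℝ E]
  {H : Type*} [TopologicalSpace H] {I : ModelWithCorners ℝ E H}
  {K : Type*} [TopologicalSpace K] [ChartedSpace H K] [Group K] [LieGroup I ∞ K]

theorem mdifferentiableAt_conj (g x : K) :
    MDifferentiableAt I I (fun x : K => g * x * g⁻¹) x :=
  ((contMDiff_mul_left (I := I) (n := ∞) (a := g)).mul
    (contMDiff_const (c := g⁻¹))).mdifferentiableAt (by simp)

/-- Conjugation by `g` carries curves through `1` with velocity `v` to ones with velocity
`Ad_g v`. -/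
theorem hasMFDerivAt_conj (g : K) {v : GroupLieAlgebra I K} {γ : ℝ → K} (h0 : γ 0 = 1)
    (h : HasMFDerivAt 𝓘(ℝ, ℝ) I γ 0 (ContinuousLinearMap.toSpanSingleton ℝ (v : E))) :
    HasMFDerivAt 𝓘(ℝ, ℝ) I (fun t => g * γ t * g⁻¹) 0
      (ContinuousLinearMap.toSpanSingleton ℝ (Ad I g v : E)) := by
  have hc := HasMFDerivAt.comp (I' := I) (0 : ℝ)
    (mdifferentiableAt_conj (I := I) g (γ 0)).hasMFDerivAt h
  refine hc.congr_mfderiv (ContinuousLinearMap.ext fun (r : ℝ) => ?_)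
  change (mfderiv I I (fun x : K => g * x * g⁻¹) (γ 0) : E →L[ℝ] E) (r • (v : E)) = _
  rw [h0]
  exact map_smul (mfderiv I I (fun x : K => g * x * g⁻¹) 1 : E →L[ℝ] E) r (v : E)

omit [Group K] [LieGroup I ∞ K] in
/-- The velocity of a curve is unique. -/
theorem eq_of_hasMFDerivAt {v w : E} {γ : ℝ → K}
    (h : HasMFDerivAt 𝓘(ℝ, ℝ) I γ 0 (ContinuousLinearMap.toSpanSingleton ℝ v))
    (h' : HasMFDerivAt 𝓘(ℝ, ℝ) I γ 0 (ContinuousLinearMap.toSpanSingleton ℝ w)) : v = w := by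
  have e := congrArg (fun f : ℝ →L[ℝ] E => f 1) (hasMFDerivAt_unique h h')
  exact (one_smul ℝ v).symm.trans (e.trans (one_smul ℝ w))

theorem Ad_apply_of_mem_centerLie {v : GroupLieAlgebra I K} (hv : v ∈ centerLie I K) (g : K) :
    Ad I g v = v := by
  obtain ⟨γ, h1, h2, h3⟩ := hv
  have h0 : γ 0 = 1 := by simpa using h1 0 0
  have e : (fun t => g * γ t * g⁻¹) = γ := by
    ext t
    rw [Subgroup.mem_center_iff.1 (h2 t) g, mul_inv_cancel_right]
  have := hasMFDerivAt_conj g h0 h3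
  rw [e] at this
  exact eq_of_hasMFDerivAt (I := I) this h3

/-- Conjugating the one-parameter subgroup of v by g gives one with velocity Ad_g v = v, hence the
same one; so it commutes with every g. -/
theorem mem_centerLie_of_forall_Ad_apply [T2Space K] [BoundarylessManifold I K] [CompleteSpace E]
    {v : GroupLieAlgebra I K} (hv : ∀ g : K, Ad I g v = v) : v ∈ centerLie I K := by
  obtain ⟨γ, h1, h3⟩ := exists_hom_hasMFDerivAt (I := I) (G := K) v
  have h0 : γ 0 = 1 := by simpa using h1 0 0
  refine ⟨γ, h1, fun t => Subgroup.mem_center_iff.2 fun g => ?_, h3⟩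
  have h := hasMFDerivAt_conj g h0 h3
  rw [hv] at h
  have e := congrFun (hom_ext_of_hasMFDerivAt (I := I) (v := (v : E))
    (γ := fun t => g * γ t * g⁻¹) (fun s t => by simp [h1, mul_assoc]) h1 h h3) t
  exact mul_inv_eq_iff_eq_mul.1 e

variable {E' : Type*} [NormedAddCommGroup E'] [NormedSpace ℝ E']
  {H' : Type*} [TopologicalSpace H'] {I' : ModelWithCorners ℝ E' H'}
  [ChartedSpace H' (K ⧸ Subgroup.center K)]

omit [LieGroup I ∞ K] in
theorem hasMFDerivAt_mk (hL : IsQuotientStructure I K I') {v : GroupLieAlgebra I K} {γ : ℝ → K}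
    (h0 : γ 0 = 1)
    (h : HasMFDerivAt 𝓘(ℝ, ℝ) I γ 0 (ContinuousLinearMap.toSpanSingleton ℝ (v : E))) :
    HasMFDerivAt 𝓘(ℝ, ℝ) I' (fun t => (γ t : K ⧸ Subgroup.center K)) 0
      (ContinuousLinearMap.toSpanSingleton ℝ (projLie I K I' v : E')) := by
  have hc := HasMFDerivAt.comp (I' := I) (0 : ℝ)
    ((hL.contMDiff (γ 0)).mdifferentiableAt (by simp)).hasMFDerivAt h
  refine hc.congr_mfderiv (ContinuousLinearMap.ext fun (r : ℝ) => ?_)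
  change (mfderiv I I' (QuotientGroup.mk : K → K ⧸ Subgroup.center K) (γ 0) : E →L[ℝ] E')
    (r • (v : E)) = _
  rw [h0]
  exact map_smul (mfderiv I I' (QuotientGroup.mk : K → K ⧸ Subgroup.center K) 1 : E →L[ℝ] E') r
    (v : E)

variable [LieGroup I' ∞ (K ⧸ Subgroup.center K)]

/-- The kernel of `𝔨 → 𝔩` is the Lie algebra of the center. -/
theorem ker_projLie [T2Space K] [BoundarylessManifold I K] [CompleteSpace E]
    [BoundarylessManifold I' (K ⧸ Subgroup.center K)] (hL : IsQuotientStructure I K I') :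
    LinearMap.ker (projLie I K I') = centerLie I K := by
  have : IsTopologicalGroup K := topologicalGroup_of_lieGroup I ∞
  have := t2Space_quotient_center (K := K)
  have hconst : HasMFDerivAt 𝓘(ℝ, ℝ) I' (fun _ : ℝ => (1 : K ⧸ Subgroup.center K)) 0
      (ContinuousLinearMap.toSpanSingleton ℝ (0 : E')) := by
    refine (hasMFDerivAt_const (I := 𝓘(ℝ, ℝ)) (I' := I') (1 : K ⧸ Subgroup.center K)
      (0 : ℝ)).congr_mfderiv (ContinuousLinearMap.ext fun (r : ℝ) => ?_)
    exact (smul_zero (A := E') r).symm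
  refine le_antisymm (fun v hv => ?_) ?_
  · obtain ⟨γ, h1, h3⟩ := exists_hom_hasMFDerivAt (I := I) (G := K) v
    have h0 : γ 0 = 1 := by simpa using h1 0 0
    refine ⟨γ, h1, fun t => (QuotientGroup.eq_one_iff _).1 ?_, h3⟩
    have h := hasMFDerivAt_mk hL h0 h3
    rw [LinearMap.mem_ker.1 hv] at h
    -- The image of γ in the quotient has velocity 0, as does the trivial homomorphism, so γ takes
    -- values in the center.
    exact congrFun (hom_ext_of_hasMFDerivAt (I := I') (v := (0 : E'))
      (γ := fun t => (γ t : K ⧸ Subgroup.center K)) (fun s t => by simp [h1])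
      (by simp) h hconst) t
  · rintro v ⟨γ, h1, h2, h3⟩
    have h0 : γ 0 = 1 := by simpa using h1 0 0
    have h := hasMFDerivAt_mk hL h0 h3
    rw [show (fun t => (γ t : K ⧸ Subgroup.center K)) = fun _ => 1 from
      funext fun t => (QuotientGroup.eq_one_iff _).2 (h2 t)] at h
    exact eq_of_hasMFDerivAt (I := I') h hconst

/-- Differentiate π(k x k⁻¹) = π(k) π(x) π(k)⁻¹ at x = 1. -/
theorem projLie_Ad (hL : IsQuotientStructure I K I') (k : K) (v : GroupLieAlgebra I K) :
    projLie I K I' (Ad I k v) = Ad I' (k : K ⧸ Subgroup.center K) (projLie I K I' v) := by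
  have hπ : ∀ x, MDifferentiableAt I I' (QuotientGroup.mk : K → K ⧸ Subgroup.center K) x :=
    fun x => (hL.contMDiff x).mdifferentiableAt (by simp)
  have h1 := HasMFDerivAt.comp (I' := I) (1 : K) (hπ (k * 1 * k⁻¹)).hasMFDerivAt
    (mdifferentiableAt_conj (I := I) k 1).hasMFDerivAt
  have h2 := HasMFDerivAt.comp (I' := I') (1 : K)
    (mdifferentiableAt_conj (I := I') (k : K ⧸ Subgroup.center K) ((1 : K) : _)).hasMFDerivAt
    (hπ 1).hasMFDerivAt
  have h := congrArg (fun f : E →L[ℝ] E' => f v) (hasMFDerivAt_unique h1 h2)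
  have e : k * 1 * k⁻¹ = 1 := by simp
  have h' : (mfderiv I I' (QuotientGroup.mk : K → K ⧸ Subgroup.center K) (k * 1 * k⁻¹) :
    E →L[ℝ] E') (Ad I k v : E) = Ad I' (k : K ⧸ Subgroup.center K) (projLie I K I' v) := h
  rwa [e] at h'

end Center

/-! ### Multiplication and left invariant fields in the chart at 1 -/

section Chart

open Set Filter Topology VectorField

variable {E : Type*} [NormedAddCommGroup E] [NormedSpace ℝ E]
  {G : Type*} [TopologicalSpace G] [ChartedSpace E G] [Group G]

variable (E G) in
/-- The multiplication of a Lie group in the chart at `1`. -/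
def chartMul (p : E × E) : E :=
  extChartAt 𝓘(ℝ, E) (1 : G)
    ((extChartAt 𝓘(ℝ, E) (1 : G)).symm p.1 * (extChartAt 𝓘(ℝ, E) (1 : G)).symm p.2)

variable (E G) in
/-- The identity of a Lie group in the chart at `1`. -/
def chartOne : E := extChartAt 𝓘(ℝ, E) (1 : G) 1

theorem extChartAt_symm_chartOne : (extChartAt 𝓘(ℝ, E) (1 : G)).symm (chartOne E G) = 1 :=
  extChartAt_to_inv 1

theorem extChartAt_target_mem_nhds_chartOne :
    (extChartAt 𝓘(ℝ, E) (1 : G)).target ∈ 𝓝 (chartOne E G) :=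
  extChartAt_target_mem_nhds 1

variable [LieGroup 𝓘(ℝ, E) ∞ G]

theorem contMDiffAt_extChartAt_symm_chartOne :
    ContMDiffAt 𝓘(ℝ, E) 𝓘(ℝ, E) ∞ (extChartAt 𝓘(ℝ, E) (1 : G)).symm (chartOne E G) :=
  (contMDiffOn_extChartAt_symm (I := 𝓘(ℝ, E)) (n := ∞) (1 : G)).contMDiffAt
    extChartAt_target_mem_nhds_chartOne

theorem contDiffAt_chartMul :
    ContDiffAt ℝ ∞ (chartMul E G) (chartOne E G, chartOne E G) := by
  rw [← contMDiffAt_iff_contDiffAt]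
  have h1 : ContMDiffAt 𝓘(ℝ, E × E) 𝓘(ℝ, E) ∞
      (fun p : E × E => (extChartAt 𝓘(ℝ, E) (1 : G)).symm p.1) (chartOne E G, chartOne E G) :=
    ContMDiffAt.comp (I' := 𝓘(ℝ, E)) (chartOne E G, chartOne E G)
      contMDiffAt_extChartAt_symm_chartOne contDiffAt_fst.contMDiffAt
  have h2 : ContMDiffAt 𝓘(ℝ, E × E) 𝓘(ℝ, E) ∞
      (fun p : E × E => (extChartAt 𝓘(ℝ, E) (1 : G)).symm p.2) (chartOne E G, chartOne E G) :=
    ContMDiffAt.comp (I' := 𝓘(ℝ, E)) (chartOne E G, chartOne E G)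
      contMDiffAt_extChartAt_symm_chartOne contDiffAt_snd.contMDiffAt
  refine ContMDiffAt.comp (I' := 𝓘(ℝ, E)) (chartOne E G, chartOne E G)
    (contMDiffAt_extChartAt' ?_) (h1.mul h2)
  rw [extChartAt_symm_chartOne, mul_one]
  exact mem_chart_source E (1 : G)

theorem eventually_differentiableAt_chartMul :
    ∀ᶠ p in 𝓝 (chartOne E G, chartOne E G), DifferentiableAt ℝ (chartMul E G) p :=
  ((contDiffAt_chartMul (E := E) (G := G)).of_le (m := 1) (by norm_num)).eventually
    (by simp) |>.mono fun _ h => h.differentiableAt (by simp)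

theorem eventually_differentiableAt_chartMul_left :
    ∀ᶠ x in 𝓝 (chartOne E G), DifferentiableAt ℝ (chartMul E G) (x, chartOne E G) :=
  (Continuous.prodMk_left (chartOne E G)).continuousAt.eventually
    eventually_differentiableAt_chartMul

theorem eventually_differentiableAt_chartMul_right :
    ∀ᶠ x in 𝓝 (chartOne E G), DifferentiableAt ℝ (chartMul E G) (chartOne E G, x) :=
  (Continuous.prodMk_right (chartOne E G)).continuousAt.eventually
    eventually_differentiableAt_chartMul

omit [LieGroup 𝓘(ℝ, E) ∞ G] in
theorem eventually_chartMul_chartOne :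
    ∀ᶠ x in 𝓝 (chartOne E G), chartMul E G (x, chartOne E G) = x :=
  mem_of_superset extChartAt_target_mem_nhds_chartOne fun x hx => by
    change extChartAt 𝓘(ℝ, E) (1 : G) (_ * (extChartAt 𝓘(ℝ, E) (1 : G)).symm (chartOne E G)) = x
    rw [extChartAt_symm_chartOne, mul_one, PartialEquiv.right_inv _ hx]

omit [LieGroup 𝓘(ℝ, E) ∞ G] in
theorem eventually_chartOne_chartMul :
    ∀ᶠ x in 𝓝 (chartOne E G), chartMul E G (chartOne E G, x) = x :=
  mem_of_superset extChartAt_target_mem_nhds_chartOne fun x hx => by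
    change extChartAt 𝓘(ℝ, E) (1 : G) ((extChartAt 𝓘(ℝ, E) (1 : G)).symm (chartOne E G) * _) = x
    rw [extChartAt_symm_chartOne, one_mul, PartialEquiv.right_inv _ hx]

/-- The partial derivative of the multiplication at `1` in the second variable. -/
theorem fderiv_chartMul_inr (v : E) :
    fderiv ℝ (chartMul E G) (chartOne E G, chartOne E G) (0, v) = v := by
  have h := (contDiffAt_chartMul (E := E) (G := G)).differentiableAt (by simp)
  have hc := h.hasFDerivAt.comp (chartOne E G) (hasFDerivAt_prodMk_right (chartOne E G) (chartOne E G))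
  have hid := (hasFDerivAt_id (𝕜 := ℝ) (chartOne E G)).congr_of_eventuallyEq
    (f₁ := fun x => chartMul E G (chartOne E G, x)) eventually_chartOne_chartMul
  exact congrArg (fun f : E →L[ℝ] E => f v) (hc.unique hid)

/-- The partial derivative of the multiplication at `1` in the first variable. -/
theorem fderiv_chartMul_inl (v : E) :
    fderiv ℝ (chartMul E G) (chartOne E G, chartOne E G) (v, 0) = v := by
  have h := (contDiffAt_chartMul (E := E) (G := G)).differentiableAt (by simp)
  have hc := HasFDerivAt.comp (f := fun x => (x, chartOne E G)) (chartOne E G) h.hasFDerivAt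
    (hasFDerivAt_prodMk_left (chartOne E G) (chartOne E G))
  have hid := (hasFDerivAt_id (𝕜 := ℝ) (chartOne E G)).congr_of_eventuallyEq
    (f₁ := fun x => chartMul E G (x, chartOne E G)) eventually_chartMul_chartOne
  exact congrArg (fun f : E →L[ℝ] E => f v) (hc.unique hid)

variable (E G) in
/-- The left invariant vector field generated by `v`, in the chart at `1`. -/
def chartField (v : E) (x : E) : E := fderiv ℝ (chartMul E G) (x, chartOne E G) (0, v)

/-- The tangent space at 1 is identified with E through this very chart, so no change of coordinates
enters the later formulas. -/
theorem hasMFDerivAt_extChartAt_symm_chartOne :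
    HasMFDerivAt 𝓘(ℝ, E) 𝓘(ℝ, E) (extChartAt 𝓘(ℝ, E) (1 : G)).symm (chartOne E G)
      (ContinuousLinearMap.id ℝ E) := by
  have : IsManifold 𝓘(ℝ, E) 1 G := IsManifold.of_le (n := ∞) (by norm_num)
  have h := (contMDiffAt_extChartAt_symm_chartOne (E := E) (G := G)).mdifferentiableAt (by simp)
  refine h.hasMFDerivAt.congr_mfderiv ?_
  have := mfderivWithin_range_extChartAt_symm (I := 𝓘(ℝ, E)) (x := (1 : G))
  rw [modelWithCornersSelf_coe, range_id, mfderivWithin_univ] at this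
  exact this

/-- With φ the chart and g = φ⁻¹(x), the map y ↦ `chartMul E G (x, y)` is φ ∘ (g * ·) ∘ φ⁻¹; its
derivative at the identity is dφ applied to the left invariant field at g, and dφ inverts the
derivative of φ⁻¹ at x. -/
theorem mpullbackWithin_mulInvariantVectorField (v : GroupLieAlgebra 𝓘(ℝ, E) G) :
    ∀ᶠ x in 𝓝 (chartOne E G),
      (mpullbackWithin 𝓘(ℝ, E) 𝓘(ℝ, E) (extChartAt 𝓘(ℝ, E) (1 : G)).symm
        (mulInvariantVectorField v) (range 𝓘(ℝ, E)) x : E) = chartField E G (v : E) x := by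
  have : IsManifold 𝓘(ℝ, E) 1 G := IsManifold.of_le (n := ∞) (by norm_num)
  filter_upwards [extChartAt_target_mem_nhds_chartOne,
    eventually_differentiableAt_chartMul_left (E := E) (G := G)] with x hx hd
  set g := (extChartAt 𝓘(ℝ, E) (1 : G)).symm x with hg
  have hgs : g ∈ (extChartAt 𝓘(ℝ, E) (1 : G)).source := PartialEquiv.map_target _ hx
  have h1 := hd.hasFDerivAt.comp (chartOne E G) (hasFDerivAt_prodMk_right x (chartOne E G))
  have hm : g * (extChartAt 𝓘(ℝ, E) (1 : G)).symm (chartOne E G) = g := by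
    rw [extChartAt_symm_chartOne, mul_one]
  have hmul : MDifferentiableAt 𝓘(ℝ, E) 𝓘(ℝ, E) (g * ·)
      ((extChartAt 𝓘(ℝ, E) (1 : G)).symm (chartOne E G)) :=
    (contMDiff_mul_left (I := 𝓘(ℝ, E)) (n := ∞)).mdifferentiableAt (by simp)
  have hφ : MDifferentiableAt 𝓘(ℝ, E) 𝓘(ℝ, E) (extChartAt 𝓘(ℝ, E) (1 : G))
      (g * (extChartAt 𝓘(ℝ, E) (1 : G)).symm (chartOne E G)) := by
    rw [hm]
    exact mdifferentiableAt_extChartAt (by simpa using hgs)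
  have h2 := HasMFDerivAt.comp (I' := 𝓘(ℝ, E)) (chartOne E G) hφ.hasMFDerivAt
    (HasMFDerivAt.comp (I' := 𝓘(ℝ, E)) (chartOne E G) hmul.hasMFDerivAt
      (hasMFDerivAt_extChartAt_symm_chartOne (E := E) (G := G)))
  have h3 : chartField E G (v : E) x = (mfderiv 𝓘(ℝ, E) 𝓘(ℝ, E) (extChartAt 𝓘(ℝ, E) (1 : G))
      (g * (extChartAt 𝓘(ℝ, E) (1 : G)).symm (chartOne E G)) : E →L[ℝ] E)
      ((mfderiv 𝓘(ℝ, E) 𝓘(ℝ, E) (g * ·)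
        ((extChartAt 𝓘(ℝ, E) (1 : G)).symm (chartOne E G)) : E →L[ℝ] E) (v : E)) :=
    congrArg (fun f : E →L[ℝ] E => f v) (hasMFDerivAt_unique h1.hasMFDerivAt h2)
  rw [hm, extChartAt_symm_chartOne] at h3
  have hinv := isInvertible_mfderivWithin_extChartAt_symm (I := 𝓘(ℝ, E)) hx
  have hcomp := mfderivWithin_extChartAt_symm_comp_mfderiv_extChartAt' (I := 𝓘(ℝ, E)) hgs
  rw [PartialEquiv.right_inv _ hx] at hcomp
  have h4 : (mfderivWithin 𝓘(ℝ, E) 𝓘(ℝ, E) (extChartAt 𝓘(ℝ, E) (1 : G)).symm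
      (range 𝓘(ℝ, E)) x : E →L[ℝ] E) (chartField E G (v : E) x) =
      (mulInvariantVectorField v g : E) := by
    rw [h3]
    exact congrArg (fun f : E →L[ℝ] E => f (mulInvariantVectorField v g : E)) hcomp
  change (mfderivWithin 𝓘(ℝ, E) 𝓘(ℝ, E) (extChartAt 𝓘(ℝ, E) (1 : G)).symm
      (range 𝓘(ℝ, E)) x : E →L[ℝ] E).inverse (mulInvariantVectorField v g : E) = _
  rw [← h4]
  obtain ⟨L, hL⟩ : ∃ L : E ≃L[ℝ] E, (L : E →L[ℝ] E) = (mfderivWithin 𝓘(ℝ, E) 𝓘(ℝ, E)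
    (extChartAt 𝓘(ℝ, E) (1 : G)).symm (range 𝓘(ℝ, E)) x : E →L[ℝ] E) := hinv
  rw [← hL]
  exact (congrArg (fun f : E →L[ℝ] E => f _) (ContinuousLinearMap.inverse_equiv L)).trans
    (L.symm_apply_apply _)

theorem bracket_eq_lieBracket_chartField (v w : GroupLieAlgebra 𝓘(ℝ, E) G) :
    (⁅v, w⁆ : GroupLieAlgebra 𝓘(ℝ, E) G) =
      (lieBracket ℝ (chartField E G (v : E)) (chartField E G (w : E)) (chartOne E G) : E) := by
  have : IsManifold 𝓘(ℝ, E) 1 G := IsManifold.of_le (n := ∞) (by norm_num)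
  rw [GroupLieAlgebra.bracket_def, ← mlieBracketWithin_univ, mlieBracketWithin_apply]
  have h : (mfderiv 𝓘(ℝ, E) 𝓘(ℝ, E) (extChartAt 𝓘(ℝ, E) (1 : G)) 1 : E →L[ℝ] E) =
    ContinuousLinearMap.id ℝ E := mfderiv_extChartAt_self
  have h' : (mfderiv 𝓘(ℝ, E) 𝓘(ℝ, E) (extChartAt 𝓘(ℝ, E) (1 : G)) 1 : E →L[ℝ] E).inverse =
    ContinuousLinearMap.id ℝ E := by rw [h]; exact ContinuousLinearMap.inverse_id
  refine (congrArg (fun f : E →L[ℝ] E => f _) h').trans ?_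
  have hu : ((extChartAt 𝓘(ℝ, E) (1 : G)).symm ⁻¹' univ ∩ range 𝓘(ℝ, E)) = univ := by simp
  rw [hu]
  refine (congrFun lieBracketWithin_univ _).trans ?_
  exact EventuallyEq.lieBracket_vectorField_eq (mpullbackWithin_mulInvariantVectorField v)
    (mpullbackWithin_mulInvariantVectorField w)

end Chart

/-! ### Brackets: homomorphisms preserve them, Ad-invariant functionals kill them -/

section Bracket

open Set Filter Topology VectorField

variable {E : Type*} [NormedAddCommGroup E] [NormedSpace ℝ E]
  {G : Type*} [TopologicalSpace G] [ChartedSpace E G] [Group G] [LieGroup 𝓘(ℝ, E) ∞ G]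
  {E' : Type*} [NormedAddCommGroup E'] [NormedSpace ℝ E']
  {G' : Type*} [TopologicalSpace G'] [ChartedSpace E' G'] [Group G'] [LieGroup 𝓘(ℝ, E') ∞ G']

theorem differentiableAt_fderiv_chartMul :
    DifferentiableAt ℝ (fderiv ℝ (chartMul E G)) (chartOne E G, chartOne E G) :=
  ((contDiffAt_chartMul (E := E) (G := G)).fderiv_right (m := 1)
    (by rw [one_add_one_eq_two]; exact ENat.LEInfty.out)).differentiableAt
    (by simp)

theorem hasFDerivAt_chartField (v : E) :
    HasFDerivAt (chartField E G v)
      ((ContinuousLinearMap.apply ℝ E ((0, v) : E × E)).comp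
        ((fderiv ℝ (fderiv ℝ (chartMul E G)) (chartOne E G, chartOne E G)).comp
          (ContinuousLinearMap.inl ℝ E E))) (chartOne E G) :=
  (ContinuousLinearMap.apply ℝ E ((0, v) : E × E)).hasFDerivAt.comp (chartOne E G)
    (HasFDerivAt.comp (f := fun x => (x, chartOne E G)) (chartOne E G)
      differentiableAt_fderiv_chartMul.hasFDerivAt
      (hasFDerivAt_prodMk_left (chartOne E G) (chartOne E G)))

theorem chartField_chartOne (v : E) : chartField E G v (chartOne E G) = v :=
  fderiv_chartMul_inr v

/-- Each field is a partial derivative of the multiplication and takes its generator as value at the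
identity, so only mixed second derivatives appear. -/
theorem lieBracket_chartField (v w : E) :
    lieBracket ℝ (chartField E G v) (chartField E G w) (chartOne E G) =
      fderiv ℝ (fderiv ℝ (chartMul E G)) (chartOne E G, chartOne E G) (v, 0) (0, w) -
      fderiv ℝ (fderiv ℝ (chartMul E G)) (chartOne E G, chartOne E G) (w, 0) (0, v) := by
  rw [lieBracket_eq]
  change fderiv ℝ (chartField E G w) (chartOne E G) (chartField E G v (chartOne E G)) -
    fderiv ℝ (chartField E G v) (chartOne E G) (chartField E G w (chartOne E G)) = _
  rw [(hasFDerivAt_chartField v).fderiv, (hasFDerivAt_chartField w).fderiv,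
    chartField_chartOne, chartField_chartOne]
  rfl

/-- A smooth map fixing the identity, in the charts at `1`. -/
def chartMap (E E' : Type*) [NormedAddCommGroup E] [NormedSpace ℝ E] [NormedAddCommGroup E']
    [NormedSpace ℝ E'] {G G' : Type*} [TopologicalSpace G] [ChartedSpace E G] [Group G]
    [TopologicalSpace G'] [ChartedSpace E' G'] [Group G'] (f : G → G') (x : E) : E' :=
  extChartAt 𝓘(ℝ, E') (1 : G') (f ((extChartAt 𝓘(ℝ, E) (1 : G)).symm x))

omit [LieGroup 𝓘(ℝ, E) ∞ G] [LieGroup 𝓘(ℝ, E') ∞ G'] in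
theorem chartMap_chartOne {f : G → G'} (h1 : f 1 = 1) :
    chartMap E E' f (chartOne E G) = chartOne E' G' := by
  rw [chartMap, extChartAt_symm_chartOne, h1]
  rfl

theorem contDiffAt_chartMap {f : G → G'} (h1 : f 1 = 1)
    (hf : ContMDiffAt 𝓘(ℝ, E) 𝓘(ℝ, E') ∞ f 1) :
    ContDiffAt ℝ ∞ (chartMap E E' f) (chartOne E G) := by
  rw [← contMDiffAt_iff_contDiffAt]
  rw [← extChartAt_symm_chartOne (E := E) (G := G)] at hf h1
  refine ContMDiffAt.comp (I' := 𝓘(ℝ, E')) (chartOne E G)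
    (g := extChartAt 𝓘(ℝ, E') (1 : G')) (contMDiffAt_extChartAt' ?_)
    (ContMDiffAt.comp (I' := 𝓘(ℝ, E)) (chartOne E G) hf contMDiffAt_extChartAt_symm_chartOne)
  rw [h1]
  exact mem_chart_source E' (1 : G')

theorem hasFDerivAt_chartMap {f : G → G'} (h1 : f 1 = 1)
    (hf : MDifferentiableAt 𝓘(ℝ, E) 𝓘(ℝ, E') f 1) :
    HasFDerivAt (chartMap E E' f) (mfderiv 𝓘(ℝ, E) 𝓘(ℝ, E') f 1 : E →L[ℝ] E')
      (chartOne E G) := by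
  have : IsManifold 𝓘(ℝ, E') 1 G' := IsManifold.of_le (n := ∞) (by norm_num)
  have hs : (extChartAt 𝓘(ℝ, E) (1 : G)).symm (chartOne E G) = 1 := extChartAt_symm_chartOne
  have hf' : HasMFDerivAt 𝓘(ℝ, E) 𝓘(ℝ, E') f ((extChartAt 𝓘(ℝ, E) (1 : G)).symm (chartOne E G))
      (mfderiv 𝓘(ℝ, E) 𝓘(ℝ, E') f 1 : E →L[ℝ] E') := by
    rw [hs]; exact hf.hasMFDerivAt
  have hφ : HasMFDerivAt 𝓘(ℝ, E') 𝓘(ℝ, E') (extChartAt 𝓘(ℝ, E') (1 : G'))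
      (f ((extChartAt 𝓘(ℝ, E) (1 : G)).symm (chartOne E G))) (ContinuousLinearMap.id ℝ E') := by
    rw [hs, h1]
    exact (mdifferentiableAt_extChartAt (mem_chart_source E' (1 : G'))).hasMFDerivAt.congr_mfderiv
      mfderiv_extChartAt_self
  exact (HasMFDerivAt.comp (I' := 𝓘(ℝ, E')) (chartOne E G) hφ
    (HasMFDerivAt.comp (I' := 𝓘(ℝ, E)) (chartOne E G) hf'
      hasMFDerivAt_extChartAt_symm_chartOne)).hasFDerivAt

theorem continuousAt_extChartAt_symm_chartOne :
    ContinuousAt (extChartAt 𝓘(ℝ, E) (1 : G)).symm (chartOne E G) :=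
  (contMDiffAt_extChartAt_symm_chartOne (E := E) (G := G)).continuousAt

omit [LieGroup 𝓘(ℝ, E') ∞ G'] in
theorem chartMap_chartMul (f : G →* G') (hf : ContinuousAt f 1) :
    ∀ᶠ p in 𝓝 (chartOne E G, chartOne E G), chartMap E E' f (chartMul E G p) =
      chartMul E' G' (chartMap E E' f p.1, chartMap E E' f p.2) := by
  have : IsTopologicalGroup G := topologicalGroup_of_lieGroup 𝓘(ℝ, E) ∞
  have hs : (extChartAt 𝓘(ℝ, E) (1 : G)).symm (chartOne E G) = 1 := extChartAt_symm_chartOne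
  have hc := continuousAt_extChartAt_symm_chartOne (E := E) (G := G)
  have c1 : ContinuousAt (fun p : E × E => (extChartAt 𝓘(ℝ, E) (1 : G)).symm p.1)
      (chartOne E G, chartOne E G) :=
    ContinuousAt.comp (g := (extChartAt 𝓘(ℝ, E) (1 : G)).symm) hc continuousAt_fst
  have c2 : ContinuousAt (fun p : E × E => (extChartAt 𝓘(ℝ, E) (1 : G)).symm p.2)
      (chartOne E G, chartOne E G) :=
    ContinuousAt.comp (g := (extChartAt 𝓘(ℝ, E) (1 : G)).symm) hc continuousAt_snd
  have hfs : ∀ {u : E × E → G}, ContinuousAt u (chartOne E G, chartOne E G) →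
      u (chartOne E G, chartOne E G) = 1 → ∀ᶠ p in 𝓝 (chartOne E G, chartOne E G),
        f (u p) ∈ (extChartAt 𝓘(ℝ, E') (1 : G')).source := fun {u} hu hu1 => by
    have : ContinuousAt (fun p => f (u p)) (chartOne E G, chartOne E G) :=
      ContinuousAt.comp (g := f) (by rwa [hu1]) hu
    refine this.eventually_mem (extChartAt_source_mem_nhds' ?_)
    rw [hu1, map_one]
    exact mem_extChartAt_source (1 : G')
  filter_upwards [hfs c1 hs, hfs c2 hs, (c1.mul c2).eventually_mem
    (extChartAt_source_mem_nhds' (I := 𝓘(ℝ, E)) (x := (1 : G)) (by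
      change (extChartAt 𝓘(ℝ, E) (1 : G)).symm (chartOne E G) *
        (extChartAt 𝓘(ℝ, E) (1 : G)).symm (chartOne E G) ∈ _
      rw [hs, mul_one]; exact mem_extChartAt_source (1 : G)))] with p h1 h2 h3
  rw [Pi.mul_apply] at h3
  simp only [chartMap, chartMul]
  rw [PartialEquiv.left_inv _ h1, PartialEquiv.left_inv _ h2, PartialEquiv.left_inv _ h3, map_mul]

/-- Differentiating f(x y) = f(x) f(y) in y at the identity shows that the left invariant fields of
v and D v are f-related near the identity. -/
theorem fderiv_chartMap_chartField (f : G →* G') (hf : ContMDiffAt 𝓘(ℝ, E) 𝓘(ℝ, E') ∞ f 1)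
    {D : E →L[ℝ] E'} (hD : HasFDerivAt (chartMap E E' f) D (chartOne E G)) (v : E) :
    ∀ᶠ x in 𝓝 (chartOne E G), fderiv ℝ (chartMap E E' f) x (chartField E G v x) =
      chartField E' G' (D v) (chartMap E E' f x) := by
  have hd := contDiffAt_chartMap (map_one f) hf
  have h0 := chartMap_chartOne (E := E) (E' := E') (map_one f)
  have hcd : ContinuousAt (chartMap E E' f) (chartOne E G) := hd.continuousAt
  have h1 := (hd.of_le (m := 1) (by norm_num)).eventually (by simp)
  have h2 : ∀ᶠ x in 𝓝 (chartOne E G),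
      DifferentiableAt ℝ (chartMul E' G') (chartMap E E' f x, chartOne E' G') :=
    hcd.eventually (by rw [h0]; exact eventually_differentiableAt_chartMul_left)
  have h3 := (chartMap_chartMul (E := E) (E' := E') f hf.continuousAt).curry_nhds
  filter_upwards [h1, h2, h3, eventually_differentiableAt_chartMul_left (E := E) (G := G),
    eventually_chartMul_chartOne (E := E) (G := G)] with x k1 k2 k3 k4 k5
  have k1' : DifferentiableAt ℝ (chartMap E E' f) (chartMul E G (x, chartOne E G)) := by
    rw [k5]; exact k1.differentiableAt (by simp)
  have k2' : DifferentiableAt ℝ (chartMul E' G')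
      (chartMap E E' f x, chartMap E E' f (chartOne E G)) := by rw [h0]; exact k2
  have l := k1'.hasFDerivAt.comp (chartOne E G)
    (k4.hasFDerivAt.comp (chartOne E G) (hasFDerivAt_prodMk_right x (chartOne E G)))
  have r := k2'.hasFDerivAt.comp (chartOne E G)
    ((hasFDerivAt_prodMk_right (chartMap E E' f x) _).comp (chartOne E G) hD)
  have e := congrArg (fun u : E →L[ℝ] E' => u v)
    (l.unique (r.congr_of_eventuallyEq k3))
  rw [k5, h0] at e
  exact e

/-- Related fields have related brackets: the second-derivative terms of f cancel by symmetry. -/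
theorem map_lieBracket_chartField (f : G →* G') (hf : ContMDiffAt 𝓘(ℝ, E) 𝓘(ℝ, E') ∞ f 1)
    {D : E →L[ℝ] E'} (hD : HasFDerivAt (chartMap E E' f) D (chartOne E G)) (v w : E) :
    D (lieBracket ℝ (chartField E G v) (chartField E G w) (chartOne E G)) =
      lieBracket ℝ (chartField E' G' (D v)) (chartField E' G' (D w)) (chartOne E' G') := by
  have hd := contDiffAt_chartMap (map_one f) hf
  have h0 := chartMap_chartOne (E := E) (E' := E') (map_one f)
  have key := fderiv_apply_lieBracket hd (n := ∞) (by
      rw [minSmoothness_of_isRCLikeNormedField]; exact ENat.LEInfty.out)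
    (hasFDerivAt_chartField (E := E) (G := G) w).differentiableAt
    (hasFDerivAt_chartField (E := E) (G := G) v).differentiableAt
  have hu : ∀ u : E, fderiv ℝ (fun x => fderiv ℝ (chartMap E E' f) x (chartField E G u x))
      (chartOne E G) = (fderiv ℝ (chartField E' G' (D u)) (chartOne E' G')).comp D := fun u => by
    refine HasFDerivAt.fderiv (HasFDerivAt.congr_of_eventuallyEq ?_
      (fderiv_chartMap_chartField f hf hD u))
    have h := (hasFDerivAt_chartField (E := E') (G := G') (D u)).differentiableAt.hasFDerivAt
    rw [← h0] at h ⊢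
    exact h.comp (chartOne E G) hD
  rw [hu, hu, hD.fderiv, chartField_chartOne, chartField_chartOne] at key
  rw [key, lieBracket_eq]
  change _ = fderiv ℝ (chartField E' G' (D w)) (chartOne E' G')
      (chartField E' G' (D v) (chartOne E' G')) -
    fderiv ℝ (chartField E' G' (D v)) (chartOne E' G') (chartField E' G' (D w) (chartOne E' G'))
  rw [chartField_chartOne, chartField_chartOne]
  rfl

/-- The derivative at `1` of a smooth homomorphism of Lie groups respects the brackets. -/
theorem mfderiv_lie (f : G →* G') (hf : ContMDiffAt 𝓘(ℝ, E) 𝓘(ℝ, E') ∞ f 1)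
    (v w : GroupLieAlgebra 𝓘(ℝ, E) G) :
    (mfderiv 𝓘(ℝ, E) 𝓘(ℝ, E') f 1 : E →L[ℝ] E') ⁅v, w⁆ =
      Bracket.bracket (L := GroupLieAlgebra 𝓘(ℝ, E') G') (M := GroupLieAlgebra 𝓘(ℝ, E') G')
        ((mfderiv 𝓘(ℝ, E) 𝓘(ℝ, E') f 1 : E →L[ℝ] E') v)
        ((mfderiv 𝓘(ℝ, E) 𝓘(ℝ, E') f 1 : E →L[ℝ] E') w) := by
  have hD := hasFDerivAt_chartMap (map_one f) (hf.mdifferentiableAt (by simp))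
  exact (congrArg (mfderiv 𝓘(ℝ, E) 𝓘(ℝ, E') f 1 : E →L[ℝ] E')
    (bracket_eq_lieBracket_chartField v w)).trans
      ((map_lieBracket_chartField f hf hD v w).trans
        (bracket_eq_lieBracket_chartField (G := G') _ _).symm)

/-- The chart expression of the relation `x y = (x y x⁻¹) x`. -/
theorem chartField_eq_fderiv_chartMul_Ad (v : GroupLieAlgebra 𝓘(ℝ, E) G) :
    ∀ᶠ x in 𝓝 (chartOne E G), chartField E G (v : E) x =
      fderiv ℝ (chartMul E G) (chartOne E G, x)
        ((Ad 𝓘(ℝ, E) ((extChartAt 𝓘(ℝ, E) (1 : G)).symm x) v : E), 0) := by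
  filter_upwards [eventually_differentiableAt_chartMul_left (E := E) (G := G),
    eventually_differentiableAt_chartMul_right (E := E) (G := G)] with x h1 h2
  set g := (extChartAt 𝓘(ℝ, E) (1 : G)).symm x with hg
  have hconj : ContMDiff 𝓘(ℝ, E) 𝓘(ℝ, E) ∞ (fun y : G => g * y * g⁻¹) :=
    (contMDiff_mul_left (I := 𝓘(ℝ, E)) (n := ∞) (a := g)).mul (contMDiff_const (c := g⁻¹))
  have hone : (fun y : G => g * y * g⁻¹) 1 = 1 := by simp
  have hc := hasFDerivAt_chartMap hone ((hconj 1).mdifferentiableAt (by simp))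
  have hs : (extChartAt 𝓘(ℝ, E) (1 : G)).symm (chartOne E G) = 1 := extChartAt_symm_chartOne
  have hev : ∀ᶠ y in 𝓝 (chartOne E G), chartMul E G (x, y) =
      chartMul E G (chartMap E E (fun y : G => g * y * g⁻¹) y, x) := by
    have hcont : ContinuousAt
        (fun y => g * (extChartAt 𝓘(ℝ, E) (1 : G)).symm y * g⁻¹) (chartOne E G) :=
      ContinuousAt.comp (g := fun y : G => g * y * g⁻¹) hconj.continuous.continuousAt
        continuousAt_extChartAt_symm_chartOne
    filter_upwards [hcont.eventually_mem (extChartAt_source_mem_nhds' (I := 𝓘(ℝ, E)) (x := (1 : G))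
      (by rw [hs, mul_one, mul_inv_cancel]; exact mem_extChartAt_source (1 : G)))] with y hy
    simp only [chartMap, chartMul]
    rw [PartialEquiv.left_inv _ hy, ← hg, inv_mul_cancel_right]
  -- Differentiate both sides of `hev` in y at the identity: the left gives the left invariant
  -- field, the right gives right translation by x applied to Ad v.
  have l := h1.hasFDerivAt.comp (chartOne E G) (hasFDerivAt_prodMk_right x (chartOne E G))
  have h2' : DifferentiableAt ℝ (chartMul E G)
      (chartMap E E (fun y : G => g * y * g⁻¹) (chartOne E G), x) := by
    rw [chartMap_chartOne hone]; exact h2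
  have r := HasFDerivAt.comp (chartOne E G)
    (f := fun y => (chartMap E E (fun y : G => g * y * g⁻¹) y, x)) h2'.hasFDerivAt
    ((hasFDerivAt_prodMk_left _ x).comp (chartOne E G) hc)
  have e := congrArg (fun u : E →L[ℝ] E => u (v : E)) (l.unique (r.congr_of_eventuallyEq hev))
  have e' : chartField E G (v : E) x = fderiv ℝ (chartMul E G)
      (chartMap E E (fun y : G => g * y * g⁻¹) (chartOne E G), x)
        ((Ad 𝓘(ℝ, E) g v : E), 0) := e
  rwa [chartMap_chartOne hone] at e'

/-- A functional that is invariant under the adjoint action vanishes on brackets. -/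
theorem apply_lie_eq_zero_of_forall_Ad [CompleteSpace E] (f : E →L[ℝ] ℝ)
    (hf : ∀ (g : G) (v : GroupLieAlgebra 𝓘(ℝ, E) G), f (Ad 𝓘(ℝ, E) g v : E) = f (v : E))
    (v w : GroupLieAlgebra 𝓘(ℝ, E) G) :
    f (⁅v, w⁆ : GroupLieAlgebra 𝓘(ℝ, E) G) = 0 := by
  let D2 := fderiv ℝ (fderiv ℝ (chartMul E G)) (chartOne E G, chartOne E G)
  -- `R x` is the derivative at `1` of the right translation by `x`.
  let R : E → E →L[ℝ] E := fun x =>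
    (fderiv ℝ (chartMul E G) (chartOne E G, x)).comp (ContinuousLinearMap.inl ℝ E E)
  have hR1 : R (chartOne E G) = ContinuousLinearMap.id ℝ E :=
    ContinuousLinearMap.ext fun u => fderiv_chartMul_inl u
  have hRd : DifferentiableAt ℝ R (chartOne E G) :=
    (DifferentiableAt.comp (chartOne E G) (f := fun x => (chartOne E G, x))
      (differentiableAt_fderiv_chartMul (E := E) (G := G))
      (hasFDerivAt_prodMk_right _ _).differentiableAt).clm_comp (differentiableAt_const _)
  have hRu : ∀ u : E, HasFDerivAt (fun x => R x u)
      ((ContinuousLinearMap.apply ℝ E ((u, 0) : E × E)).comp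
        (D2.comp (ContinuousLinearMap.inr ℝ E E))) (chartOne E G) := fun u =>
    (ContinuousLinearMap.apply ℝ E ((u, 0) : E × E)).hasFDerivAt.comp (chartOne E G)
      (HasFDerivAt.comp (f := fun x => (chartOne E G, x)) (chartOne E G)
        differentiableAt_fderiv_chartMul.hasFDerivAt
        (hasFDerivAt_prodMk_right (chartOne E G) (chartOne E G)))
  -- θ is the right invariant 1-form with value f at the identity. Ad-invariance of f makes it left
  -- invariant too, so it is constant both on right invariant fields (`hθR`) and on left invariant
  -- ones (`hθA`).
  let θ : E → E →L[ℝ] ℝ := fun x => f.comp (ContinuousLinearMap.inverse (R x))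
  have hθ1 : θ (chartOne E G) = f := by
    simp only [θ, hR1, ContinuousLinearMap.inverse_id, ContinuousLinearMap.comp_id]
  have hinv : ContDiffAt ℝ 1 (ContinuousLinearMap.inverse : (E →L[ℝ] E) → E →L[ℝ] E)
      (R (chartOne E G)) := by
    rw [hR1]; exact contDiffAt_map_inverse (ContinuousLinearEquiv.refl ℝ E)
  have hθd : DifferentiableAt ℝ θ (chartOne E G) :=
    (differentiableAt_const f).clm_comp
      (DifferentiableAt.comp (chartOne E G) (hinv.differentiableAt (by simp)) hRd)
  have hθR : ∀ᶠ x in 𝓝 (chartOne E G), ∀ u, θ x (R x u) = f u := by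
    -- Invertible operators form an open set, so near the identity `inverse` is the true inverse and
    -- not its default value 0.
    have hmem : Set.range ((↑) : (E ≃L[ℝ] E) → E →L[ℝ] E) ∈ 𝓝 (R (chartOne E G)) := by
      rw [hR1]; exact ContinuousLinearEquiv.nhds (ContinuousLinearEquiv.refl ℝ E)
    filter_upwards [hRd.continuousAt hmem] with x hx u
    obtain ⟨e, he⟩ := hx
    simp only [θ, ← he, ContinuousLinearMap.inverse_equiv]
    simp
  have hθA : ∀ u : E, ∀ᶠ x in 𝓝 (chartOne E G), θ x (chartField E G u x) = f u := fun u => by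
    filter_upwards [hθR, chartField_eq_fderiv_chartMul_Ad (G := G) u] with x h1 h2
    rw [h2]
    exact (h1 _).trans (hf _ _)
  -- Differentiating the two constancy relations in direction z gives two formulas for the same
  -- derivative of θ. Comparing them, with `D2` symmetric, equates f on the two mixed derivatives
  -- whose difference is the bracket.
  have d1 : ∀ u z : E, fderiv ℝ θ (chartOne E G) z u + f (D2 (0, z) (u, 0)) = 0 := fun u z => by
    have h := (hθd.hasFDerivAt.clm_apply (hRu u)).unique
      ((hasFDerivAt_const (f u) (chartOne E G)).congr_of_eventuallyEq
        (hθR.mono fun x hx => hx u))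
    have h' := congrArg (fun l : E →L[ℝ] ℝ => l z) h
    simp only [hθ1, hR1] at h'
    simpa [add_comm] using h'
  have d2 : ∀ u z : E, fderiv ℝ θ (chartOne E G) z u + f (D2 (z, 0) (0, u)) = 0 := fun u z => by
    have h := (hθd.hasFDerivAt.clm_apply (hasFDerivAt_chartField (G := G) u)).unique
      ((hasFDerivAt_const (f u) (chartOne E G)).congr_of_eventuallyEq (hθA u))
    have h' := congrArg (fun l : E →L[ℝ] ℝ => l z) h
    simp only [hθ1, chartField_chartOne] at h'
    simpa [add_comm] using h'
  have hsymm : ∀ a b, D2 a b = D2 b a := fun a b =>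
    ((contDiffAt_chartMul (E := E) (G := G)).isSymmSndFDerivAt (by
      rw [minSmoothness_of_isRCLikeNormedField]; exact ENat.LEInfty.out)) a b
  refine (congrArg f ((bracket_eq_lieBracket_chartField v w).trans
    (lieBracket_chartField (E := E) (G := G) v w))).trans ?_
  change f (D2 (v, 0) (0, w) - D2 (w, 0) (0, v)) = 0
  have a1 := d1 w v
  have a2 := d2 w v
  rw [hsymm (0, v) (w, 0)] at a1
  rw [map_sub]
  linarith

end Bracket

/-! ### Uniqueness, equivariance and images under the splitting -/

section EquivariantSplitting

variable {V L : Type*} [AddCommGroup V] [Module ℝ V] [AddCommGroup L] [Module ℝ L]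
  {B : V →ₗ[ℝ] V →ₗ[ℝ] ℝ} {Z : Submodule ℝ V} {π : V →ₗ[ℝ] L}

variable [FiniteDimensional ℝ V]

theorem exists_orthogonal_preimage (hpos : ∀ x, x ≠ 0 → 0 < B x x)
    (hsurj : Function.Surjective π) (hker : LinearMap.ker π = Z) (l : L) :
    ∃ η, (∀ ζ : Z, B η ζ = 0) ∧ π η = l := by
  obtain ⟨P, hP⟩ := exists_orthogonal_projection hpos Z
  obtain ⟨ξ, rfl⟩ := hsurj l
  have h : π (P ξ) = 0 := LinearMap.mem_ker.1 (hker ▸ (P ξ).2)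
  exact ⟨ξ - P ξ, fun ζ => by rw [map_sub, LinearMap.sub_apply, hP, sub_self],
    by rw [map_sub, h, sub_zero]⟩

/-- An element of the target is determined by the values that define the components of `σ`. -/
theorem splitting_ext (hpos : ∀ x, x ≠ 0 → 0 < B x x)
    (hsurj : Function.Surjective π) (hker : LinearMap.ker π = Z)
    {p q : (Module.Dual ℝ L × L) × (Module.Dual ℝ Z × Z)} (h1 : p.1.2 = q.1.2)
    (h2 : ∀ ζ : Z, B p.2.2 ζ = B q.2.2 ζ)
    (h3 : ∀ η, (∀ ζ : Z, B η ζ = 0) → p.1.1 (π η) = q.1.1 (π η))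
    (h4 : ∀ ζ : Z, p.2.1 ζ = q.2.1 ζ) : p = q := by
  refine Prod.ext (Prod.ext (LinearMap.ext fun l => ?_) h1) (Prod.ext (LinearMap.ext h4) ?_)
  · obtain ⟨η, hη, rfl⟩ := exists_orthogonal_preimage hpos hsurj hker l
    exact h3 η hη
  · refine Subtype.ext (sub_eq_zero.1 (eq_zero_of_form_self_eq_zero hpos ?_))
    rw [B.map_sub, LinearMap.sub_apply]
    -- The difference of the two Z-components is itself the test vector.
    exact sub_eq_zero.2 (h2 (p.2.2 - q.2.2))

theorem IsSplitting.unique (hpos : ∀ x, x ≠ 0 → 0 < B x x)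
    (hsurj : Function.Surjective π) (hker : LinearMap.ker π = Z)
    {σ τ : (Module.Dual ℝ V × V) ≃ₗ[ℝ] (Module.Dual ℝ L × L) × (Module.Dual ℝ Z × Z)}
    (hσ : IsSplitting B π σ) (hτ : IsSplitting B π τ) : τ = σ := by
  refine LinearEquiv.ext fun ⟨μ, ξ⟩ => ?_
  obtain ⟨a1, a2, a3, a4⟩ := hσ μ ξ
  obtain ⟨b1, b2, b3, b4⟩ := hτ μ ξ
  exact splitting_ext hpos hsurj hker (b1.trans a1.symm) (fun ζ => (b2 ζ).trans (a2 ζ).symm)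
    (fun η hη => (b3 η hη).trans (a3 η hη).symm) (fun ζ => (b4 ζ).trans (a4 ζ).symm)

variable {K Q : Type*} [Group K] [Group Q] {q : K →* Q} {A : K → V →ₗ[ℝ] V} {A' : Q → L →ₗ[ℝ] L}

/-- The splitting is equivariant. -/
theorem IsSplitting.equivariant (hpos : ∀ x, x ≠ 0 → 0 < B x x)
    (hsurj : Function.Surjective π) (hker : LinearMap.ker π = Z)
    (hinv : ∀ k x y, B (A k x) (A k y) = B x y) (hAZ : ∀ k, ∀ z ∈ Z, A k z = z)
    (hπ : ∀ k x, π (A k x) = A' (q k) (π x))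
    {σ : (Module.Dual ℝ V × V) ≃ₗ[ℝ] (Module.Dual ℝ L × L) × (Module.Dual ℝ Z × Z)}
    (hσ : IsSplitting B π σ) (k : K) (p : Module.Dual ℝ V × V) :
    σ ((Module.Dual.transpose (R := ℝ) (A k⁻¹)).prodMap (A k) p) =
      ((Module.Dual.transpose (R := ℝ) (A' (q k)⁻¹)).prodMap (A' (q k)) (σ p).1, (σ p).2) := by
  obtain ⟨μ, ξ⟩ := p
  obtain ⟨a1, a2, a3, a4⟩ := hσ μ ξ
  obtain ⟨b1, b2, b3, b4⟩ := hσ (μ ∘ₗ A k⁻¹) (A k ξ)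
  -- As A k preserves B and fixes Z pointwise, it does not change pairings with Z; in particular it
  -- preserves the orthogonal complement.
  have hBZ : ∀ k x, ∀ ζ : Z, B (A k x) ζ = B x ζ := fun k x ζ => by
    conv_lhs => rw [← hAZ k ζ ζ.2]
    exact hinv k x ζ
  refine splitting_ext hpos hsurj hker ?_ (fun ζ => ?_) (fun η hη => ?_) (fun ζ => ?_)
  · refine b1.trans ((hπ k ξ).trans ?_)
    rw [← a1]; rfl
  · exact (b2 ζ).trans ((hBZ k ξ ζ).trans (a2 ζ).symm)
  · refine (b3 η hη).trans ?_
    change μ (A k⁻¹ η) = (σ (μ, ξ)).1.1 (A' (q k)⁻¹ (π η))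
    rw [← map_inv, ← hπ, a3 _ fun ζ => (hBZ k⁻¹ η ζ).trans (hη ζ)]
  · refine (b4 ζ).trans ?_
    change μ (A k⁻¹ ζ) = _
    rw [hAZ k⁻¹ ζ ζ.2, a4 ζ]

/-- The fixed points correspond to `{0} ⊕ (Z* ⊕ Z)`. -/
theorem IsSplitting.image_fixed (hpos : ∀ x, x ≠ 0 → 0 < B x x) (hsymm : ∀ x y, B x y = B y x)
    (hsurj : Function.Surjective π) (hker : LinearMap.ker π = Z)
    (hinv : ∀ k x y, B (A k x) (A k y) = B x y) (hAZ : ∀ k, ∀ z ∈ Z, A k z = z)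
    (hZA : ∀ z, (∀ k, A k z = z) → z ∈ Z) (hπ : ∀ k x, π (A k x) = A' (q k) (π x))
    {σ : (Module.Dual ℝ V × V) ≃ₗ[ℝ] (Module.Dual ℝ L × L) × (Module.Dual ℝ Z × Z)}
    (hσ : IsSplitting B π σ) :
    σ '' {p | ∀ k, (Module.Dual.transpose (R := ℝ) (A k⁻¹)).prodMap (A k) p = p} =
      {p | p.1 = 0} := by
  ext r
  constructor
  · rintro ⟨⟨μ, ξ⟩, hp, rfl⟩
    obtain ⟨a1, a2, a3, a4⟩ := hσ μ ξ
    have hξ : ξ ∈ Z := hZA ξ fun k => congrArg Prod.snd (hp k)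
    refine Prod.ext (LinearMap.ext fun l => ?_)
      (a1.trans (LinearMap.mem_ker.1 (hker ▸ hξ)))
    obtain ⟨η, hη, rfl⟩ := exists_orthogonal_preimage hpos hsurj hker l
    obtain ⟨m, rfl⟩ := exists_eq_of_posDef hpos μ
    -- Invariance of μ = B(m, ·) makes A k m - m orthogonal to the range of A k. That range is
    -- everything, since an isometry of a finite-dimensional space is onto; A itself is not assumed
    -- multiplicative.
    have hm : m ∈ Z := hZA m fun k => by
      have hy : ∀ y, B (A k m - m) (A k y) = 0 := fun y => by
        have hBm' : ∀ y, B m (A k y) = B m y := fun y => by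
          have h := hp k⁻¹
          rw [inv_inv] at h
          exact LinearMap.congr_fun (congrArg Prod.fst h) y
        rw [map_sub, LinearMap.sub_apply, hinv, hBm', sub_self]
      have hAinj : Function.Injective (A k) := by
        refine (injective_iff_map_eq_zero _).2 fun x hx => eq_zero_of_form_self_eq_zero hpos ?_
        rw [← hinv k, hx, map_zero]
      obtain ⟨y, hy'⟩ := LinearMap.injective_iff_surjective.1 hAinj (A k m - m)
      refine sub_eq_zero.1 (eq_zero_of_form_self_eq_zero hpos ?_)
      have := hy y
      rwa [hy'] at this
    rw [a3 η hη, hsymm]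
    exact hη ⟨m, hm⟩
  · intro hr
    refine ⟨σ.symm r, fun k => σ.injective ?_, σ.apply_symm_apply r⟩
    rw [hσ.equivariant hpos hsurj hker hinv hAZ hπ, σ.apply_symm_apply]
    have h : r.1 = 0 := hr
    exact Prod.ext (by rw [h, map_zero]) rfl

omit [FiniteDimensional ℝ V] in
/-- The splitting respects the pairs `(μ, ξ)` such that `μ` annihilates all brackets with `ξ`. -/
theorem IsSplitting.image_commuting {b : V → V → V} {b' : L → L → L}
    (hsurj : Function.Surjective π) (hb : ∀ x y, π (b x y) = b' (π x) (π y))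
    (horth : ∀ x y, ∀ ζ : Z, B (b x y) ζ = 0)
    {σ : (Module.Dual ℝ V × V) ≃ₗ[ℝ] (Module.Dual ℝ L × L) × (Module.Dual ℝ Z × Z)}
    (hσ : IsSplitting B π σ) :
    σ '' {p | ∀ η, p.1 (b p.2 η) = 0} = {r | ∀ η, r.1.1 (b' r.1.2 η) = 0} := by
  have key : ∀ p, (∀ η, p.1 (b p.2 η) = 0) ↔ ∀ η, (σ p).1.1 (b' (σ p).1.2 η) = 0 := by
    rintro ⟨μ, ξ⟩
    obtain ⟨a1, -, a3, -⟩ := hσ μ ξ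
    rw [a1, hsurj.forall]
    refine forall_congr' fun η => ?_
    -- The bracket is orthogonal to Z, which is where the L-component of σ recovers μ.
    rw [← hb, a3 _ (horth ξ η)]
  ext r
  constructor
  · rintro ⟨p, hp, rfl⟩
    exact (key p).1 hp
  · intro hr
    refine ⟨σ.symm r, (key _).2 ?_, σ.apply_symm_apply r⟩
    rw [σ.apply_symm_apply]
    exact hr

end EquivariantSplitting

/-- The coadjoint bracket evaluates to -μ[ξ, η], and the sign does not affect vanishing. -/
theorem commutingPairs_eq {E : Type*} [NormedAddCommGroup E] [NormedSpace ℝ E] [CompleteSpace E]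
    {H : Type*} [TopologicalSpace H] (I : ModelWithCorners ℝ E H)
    {G : Type*} [TopologicalSpace G] [ChartedSpace H G] [Group G] [LieGroup I ∞ G] :
    commutingPairs I G = {p | ∀ η, p.1 ⁅p.2, η⁆ = 0} := by
  ext p
  refine LinearMap.ext_iff.trans (forall_congr' fun η => ?_)
  exact neg_eq_zero

end CompactLie

end

theorem mainTheorem11
    {n m : ℕ} {K : Type*} [TopologicalSpace K] [T2Space K] [CompactSpace K] [ConnectedSpace K]
    [Group K] [ChartedSpace (EuclideanSpace ℝ (Fin n)) K] [LieGroup (𝓡 n) ∞ K]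
    [ChartedSpace (EuclideanSpace ℝ (Fin m)) (K ⧸ Subgroup.center K)]
    [LieGroup (𝓡 m) ∞ (K ⧸ Subgroup.center K)]
    (hL : CompactLie.IsQuotientStructure (𝓡 n) K (𝓡 m))
    (B : GroupLieAlgebra (𝓡 n) K →ₗ[ℝ] GroupLieAlgebra (𝓡 n) K →ₗ[ℝ] ℝ)
    (hB : CompactLie.IsInvariantInnerProduct (𝓡 n) B) :
    ∃ σ : (Module.Dual ℝ (GroupLieAlgebra (𝓡 n) K) × GroupLieAlgebra (𝓡 n) K) ≃ₗ[ℝ]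
        (Module.Dual ℝ (GroupLieAlgebra (𝓡 m) (K ⧸ Subgroup.center K)) ×
            GroupLieAlgebra (𝓡 m) (K ⧸ Subgroup.center K)) ×
          (Module.Dual ℝ (CompactLie.centerLie (𝓡 n) K) × CompactLie.centerLie (𝓡 n) K),
      (CompactLie.IsInducedSplitting (𝓡 n) (𝓡 m) B σ ∧
        ∀ τ, CompactLie.IsInducedSplitting (𝓡 n) (𝓡 m) B τ → τ = σ) ∧
      (∀ (k : K) (p : Module.Dual ℝ (GroupLieAlgebra (𝓡 n) K) × GroupLieAlgebra (𝓡 n) K),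
        σ (CompactLie.coAdAd (𝓡 n) k p) =
          (CompactLie.coAdAd (𝓡 m) (QuotientGroup.mk k : K ⧸ Subgroup.center K) (σ p).1,
            (σ p).2)) ∧
      σ '' CompactLie.fixedPairs (𝓡 n) K = {q | q.1 = 0} ∧
      σ '' CompactLie.commutingPairs (𝓡 n) K =
        {q | q.1 ∈ CompactLie.commutingPairs (𝓡 m) (K ⧸ Subgroup.center K)} := by
  have hfin : FiniteDimensional ℝ (GroupLieAlgebra (𝓡 n) K) :=
    inferInstanceAs (FiniteDimensional ℝ (EuclideanSpace ℝ (Fin n)))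
  have hsurj : Function.Surjective (CompactLie.projLie (𝓡 n) K (𝓡 m)) := hL.surjective_mfderiv 1
  have hker := CompactLie.ker_projLie hL
  have hAZ : ∀ k, ∀ z ∈ CompactLie.centerLie (𝓡 n) K, CompactLie.Ad (𝓡 n) k z = z :=
    fun k z hz => CompactLie.Ad_apply_of_mem_centerLie hz k
  have hπ := CompactLie.projLie_Ad hL
  have hb : ∀ x y : GroupLieAlgebra (𝓡 n) K, CompactLie.projLie (𝓡 n) K (𝓡 m) ⁅x, y⁆ =
      ⁅CompactLie.projLie (𝓡 n) K (𝓡 m) x, CompactLie.projLie (𝓡 n) K (𝓡 m) y⁆ :=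
    CompactLie.mfderiv_lie (QuotientGroup.mk' (Subgroup.center K)) (hL.contMDiff 1)
  have horth : ∀ x y : GroupLieAlgebra (𝓡 n) K, ∀ ζ : CompactLie.centerLie (𝓡 n) K,
      B ⁅x, y⁆ ζ = 0 := fun x y ζ => by
    rw [hB.symm]
    -- B(ζ, ·) is Ad-invariant because B is invariant and Ad fixes ζ, so it vanishes on brackets.
    let f : EuclideanSpace ℝ (Fin n) →ₗ[ℝ] ℝ := B ζ
    refine CompactLie.apply_lie_eq_zero_of_forall_Ad (LinearMap.toContinuousLinearMap f)
      (fun g v => ?_) x y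
    change B ζ (CompactLie.Ad (𝓡 n) g v) = B ζ v
    conv_lhs => rw [← hAZ g ζ ζ.2]
    exact hB.inv g ζ v
  obtain ⟨σ, hσ⟩ := CompactLie.exists_splitting hB.pos hsurj hker
  refine ⟨σ, ⟨⟨fun μ ξ => (hσ μ ξ).1, fun μ ξ => (hσ μ ξ).2.1, fun μ ξ => (hσ μ ξ).2.2.1,
    fun μ ξ => (hσ μ ξ).2.2.2⟩, fun τ hτ => ?_⟩, ?_, ?_, ?_⟩
  · exact hσ.unique hB.pos hsurj hker fun μ ξ =>
      ⟨hτ.snd_l μ ξ, hτ.snd_z μ ξ, hτ.fst_l μ ξ, hτ.fst_z μ ξ⟩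
  · exact hσ.equivariant (q := QuotientGroup.mk' (Subgroup.center K)) hB.pos hsurj hker hB.inv
      hAZ hπ
  · exact hσ.image_fixed (q := QuotientGroup.mk' (Subgroup.center K)) hB.pos hB.symm hsurj hker
      hB.inv hAZ (fun z => CompactLie.mem_centerLie_of_forall_Ad_apply) hπ
  · rw [CompactLie.commutingPairs_eq, CompactLie.commutingPairs_eq]
    exact hσ.image_commuting hsurj hb horth
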